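/- Let $\mathcal H$ be a separable infinite-dimensional complex Hilbert space with a fixed orthonormal basis $\mathrm e=\{e_n\}_{n\ge 1}$. An operator $D\in\mathcal B(\mathcal H)$ is called diagonal if $\langle De_n,e_m\rangle=\delta_{nm}d_n$ for some bounded sequence $(d_n)$ of complex numbers; $\mathcal D$ denotes the set of diagonal operators, and a diagonal projection is an orthogonal projection belonging to $\mathcal D$. Let $\mathcal J$ be a proper operator ideal, i.e. a two-sided ideal of $\mathcal B(\mathcal H)$ with $\{0\}\neq\mathcal J\neq\mathcal B(\mathcal H)$, and let $\mathcal U_{\mathcal J}(\mathcal H)$ be the group of unitary operators $U$ on $\mathcal H$ with $U-I\in\mathcal J$. Let $A\in\mathcal B(\mathcal H)$ be a normal operator with finite spectrum $\sigma(A)=\{\lambda_1,\dots,\lambda_N\}$ (the $\lambda_n$ distinct), and let $P_n$ be the spectral projection of $A$ at $\lambda_n$, i.e. the orthogonal projection onto $\ker(A-\lambda_nI)$. Then the following conditions are equivalent: (i) $A$ is $\mathcal U_{\mathcal J}(\mathcal H)$-diagonalizable with respect to $\mathrm e$, i.e. there is $U\in\mathcal U_{\mathcal J}(\mathcal H)$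 such that $UAU^*\in\mathcal D$; (ii) there exist diagonal projections $E_1,\dots,E_N\in\mathcal D$ such that $E_n-P_n\in\mathcal J$ for all $1\le n\le N$; (iii) there exist diagonal projections $E_1,\dots,E_N\in\mathcal D$ such that $$\sum_{n=1}^N (I-E_n)P_n\in\mathcal J\qquad\text{and}\qquad \sum_{n=1}^N E_n(I-P_n)\in\mathcal J .$$ -/

import Mathlib

namespace RestrictedDiag

variable {H : Type*} [NormedAddCommGroup H] [InnerProductSpace ℂ H]

/-- `A` is diagonal with respect to the orthonormal basis `e`: `⟨A eₙ, eₘ⟩ = δₙₘ dₙ` for some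
bounded sequence `d` of complex numbers. (Mathlib's inner product is linear in the second
variable, so the entry `⟨A eₙ, eₘ⟩` is written `inner ℂ (e m) (A (e n))`.) -/
def IsDiagonal (e : HilbertBasis ℕ ℂ H) (A : H →L[ℂ] H) : Prop :=
  ∃ d : ℕ → ℂ, (∃ C : ℝ, ∀ n, ‖d n‖ ≤ C) ∧
    ∀ n m, inner ℂ (e m) (A (e n)) = if n = m then d n else 0

/-- A proper operator ideal: a two-sided ideal `J` of `B(H)` with `{0} ≠ J ≠ B(H)`. -/
def IsProperIdeal (J : TwoSidedIdeal (H →L[ℂ] H)) : Prop :=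
  J ≠ ⊥ ∧ J ≠ ⊤

variable [CompleteSpace H]

/-- The restricted unitary group `U_J(H)`: the unitaries `U` with `U - I ∈ J`. -/
def restrictedUnitary (J : TwoSidedIdeal (H →L[ℂ] H)) : Set (H →L[ℂ] H) :=
  {U | U ∈ unitary (H →L[ℂ] H) ∧ U - 1 ∈ J}

/-- `A` is `U_J(H)`-diagonalizable with respect to `e`: `U A U*` is diagonal for some
`U ∈ U_J(H)`. -/
def IsRestrictedDiagonalizable (e : HilbertBasis ℕ ℂ H) (J : TwoSidedIdeal (H →L[ℂ] H))
    (A : H →L[ℂ] H) : Prop :=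
  ∃ U ∈ restrictedUnitary J, IsDiagonal e (U * A * star U)

/-- A diagonal (orthogonal) projection with respect to `e`. -/
def IsDiagonalProjection (e : HilbertBasis ℕ ℂ H) (E : H →L[ℂ] H) : Prop :=
  IsStarProjection E ∧ IsDiagonal e E

/-- The spectral projection of a (normal) operator `A` at the point `z`: the value at `{z}` of the
spectral measure of `A`, that is, the orthogonal projection onto `ker (A - z I)`. -/
noncomputable def spectralProjection (A : H →L[ℂ] H) (z : ℂ) : H →L[ℂ] H :=
  (A - z • (1 : H →L[ℂ] H)).ker.starProjection

end RestrictedDiag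

/-! If `U` diagonalizes `A`, each basis vector pulled back by `star U` is an eigenvector of `A`, so
`U * P n * star U` is diagonal; it differs from `P n` by an element of `J`. Passing from differences
to the two sums is algebra.

The substance is recovering `U` from the sums. Their difference is `∑ E n - 1`, which therefore lies
in `J`. Elements of a proper ideal are compact (`exists_norm_mul_one_sub_basisProj_lt`), so outside
a finite set of indices the diagonal projections partition the basis; since `J` contains all
finite-rank operators, each `E n - P n` is in `J` (`exists_partition`).

Now `∑ P n * E n` is `1` modulo `J`. Cut it down by a cofinite basis projection `Q` to get `Y` close
to `Q`. The isometric part `W` of its polar decomposition carries `E n * Q` into `P n`, and stays in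
`Q + J` because the square root is handled algebraically (`exists_inv_sqrt`). The missing
finite-dimensional piece is the kernel of `star Y`: it has exactly the dimension of the range of `1
- Q` (`finrank_ker_of_isUnit_add`) and is invariant under every `P n`, so it has an orthonormal
basis of eigenvectors of `A`. These complete `W` to a unitary, at the cost of a finite-rank term. -/

namespace RestrictedDiag

open InnerProductSpace Filter Topology

/-! ### Proper ideals lie between the finite-rank and the compact operators. -/

section CompactIdeal

variable {H : Type*} [NormedAddCommGroup H] [InnerProductSpace ℂ H]

theorem clm_ext_basis {e : HilbertBasis ℕ ℂ H} {S T : H →L[ℂ] H} (h : ∀ k, S (e k) = T (e k)) :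
    S = T := by
  refine ContinuousLinearMap.ext_on (s := Set.range e) ?_ ?_
  · have := e.dense_span
    rw [Submodule.dense_iff_topologicalClosure_eq_top]
    exact this
  · rintro _ ⟨k, rfl⟩
    exact h k

theorem ext_inner_basis {e : HilbertBasis ℕ ℂ H} {x y : H}
    (h : ∀ k, inner ℂ (e k) x = inner ℂ (e k) y) : x = y := by
  apply e.repr.injective
  ext k
  simpa [e.repr_apply_apply] using h k

theorem inner_basis (e : HilbertBasis ℕ ℂ H) (i j : ℕ) :
    inner ℂ (e i) (e j) = if i = j then (1 : ℂ) else 0 :=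
  (orthonormal_iff_ite.mp e.orthonormal) i j

theorem IsDiagonal.exists_apply_eq_smul {e : HilbertBasis ℕ ℂ H} {D : H →L[ℂ] H}
    (hD : IsDiagonal e D) (k : ℕ) : ∃ c : ℂ, D (e k) = c • e k := by
  obtain ⟨d, -, hd⟩ := hD
  refine ⟨d k, ext_inner_basis (e := e) fun m => ?_⟩
  rw [hd, inner_smul_right, inner_basis]
  by_cases h : k = m
  · simp [h]
  · simp [h, Ne.symm h]

theorem isDiagonal_of_apply_eq_smul {e : HilbertBasis ℕ ℂ H} {D : H →L[ℂ] H}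
    (hD : ∀ k, ∃ c : ℂ, D (e k) = c • e k) : IsDiagonal e D := by
  choose d hd using hD
  refine ⟨d, ⟨‖D‖, fun n => ?_⟩, fun n m => ?_⟩
  · have h := D.le_opNorm (e n)
    simpa [hd, norm_smul, e.orthonormal.1 n] using h
  · rw [hd, inner_smul_right, inner_basis]
    by_cases h : n = m
    · simp [h]
    · simp [h, Ne.symm h]

/-- The orthogonal projection onto the span of the basis vectors `e k`, `k ∈ F`. -/
noncomputable def basisProj (e : HilbertBasis ℕ ℂ H) (F : Finset ℕ) : H →L[ℂ] H :=
  ∑ k ∈ F, rankOne ℂ (e k) (e k)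

theorem basisProj_apply (e : HilbertBasis ℕ ℂ H) (F : Finset ℕ) (x : H) :
    basisProj e F x = ∑ k ∈ F, inner ℂ (e k) x • e k := by
  simp [basisProj]

theorem basisProj_basis (e : HilbertBasis ℕ ℂ H) (F : Finset ℕ) (k : ℕ) :
    basisProj e F (e k) = if k ∈ F then e k else 0 := by
  simp [basisProj_apply, inner_basis]

theorem basisProj_mul_self (e : HilbertBasis ℕ ℂ H) (F : Finset ℕ) :
    basisProj e F * basisProj e F = basisProj e F := by
  refine clm_ext_basis (e := e) fun k => ?_
  by_cases h : k ∈ F <;> simp [basisProj_basis, h]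

theorem finrank_range_basisProj (e : HilbertBasis ℕ ℂ H) (F : Finset ℕ) :
    FiniteDimensional ℂ (basisProj e F).range ∧ Module.finrank ℂ (basisProj e F).range = F.card := by
  have hr : (basisProj e F).range = Submodule.span ℂ (Set.range fun k : F => e k) := by
    apply le_antisymm
    · rintro _ ⟨x, rfl⟩
      change basisProj e F x ∈ _
      rw [basisProj_apply]
      exact Submodule.sum_mem _ fun k hk =>
        Submodule.smul_mem _ _ (Submodule.subset_span ⟨⟨k, hk⟩, rfl⟩)
    · rw [Submodule.span_le]
      rintro _ ⟨k, rfl⟩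
      exact ⟨e k, by simp [basisProj_basis]⟩
  rw [hr]
  refine ⟨FiniteDimensional.span_of_finite ℂ (Set.finite_range _), ?_⟩
  rw [finrank_span_eq_card]
  · simp
  · exact (e.orthonormal.linearIndependent).comp _ Subtype.val_injective

theorem tendsto_basisProj_apply (e : HilbertBasis ℕ ℂ H) (x : H) :
    Tendsto (fun F => basisProj e F x) atTop (𝓝 x) := by
  have h := e.hasSum_repr x
  unfold HasSum at h
  simpa [basisProj_apply, e.repr_apply_apply] using h

variable {J : TwoSidedIdeal (H →L[ℂ] H)}

/-- If `T x ≠ 0` for some `T ∈ J`, any rank-one operator factors through `T`: send `v` to `x`, apply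
`T`, then send `T x` to `u` and normalize. -/
theorem rankOne_mem (hJ : J ≠ ⊥) (u v : H) : rankOne ℂ u v ∈ J := by
  obtain ⟨T, hT, hT0⟩ : ∃ T ∈ J, T ≠ 0 := by
    by_contra! h
    exact hJ (le_bot_iff.mp fun T hT => by simpa using h T hT)
  obtain ⟨x, hx⟩ : ∃ x, T x ≠ 0 := by
    by_contra! h
    exact hT0 (ContinuousLinearMap.ext h)
  have hx' : inner ℂ (T x) (T x) ≠ 0 := by simpa using hx
  have : rankOne ℂ u v
      = ((inner ℂ (T x) (T x))⁻¹ • rankOne ℂ u (T x)) * T * rankOne ℂ x v := by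
    ext y
    simp only [mul_apply_eq_comp, smul_apply, rankOne_apply,
      map_smul, smul_smul]
    congr 1
    field_simp
  rw [this]
  exact J.mul_mem_right _ _ (J.mul_mem_left _ _ hT)

theorem basisProj_mem (hJ : J ≠ ⊥) (e : HilbertBasis ℕ ℂ H) (F : Finset ℕ) :
    basisProj e F ∈ J :=
  sum_mem fun _ _ => rankOne_mem hJ _ _

variable [CompleteSpace H]

theorem star_basisProj (e : HilbertBasis ℕ ℂ H) (F : Finset ℕ) :
    star (basisProj e F) = basisProj e F := by
  simp [basisProj, star_sum, ContinuousLinearMap.star_eq_adjoint]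

/-- If `T` is not small off any finite-dimensional subspace, then some orthonormal sequence is
mapped by `T` to an orthogonal sequence bounded away from zero. -/
theorem exists_orthonormal_of_not_small {T : H →L[ℂ] H} {c : ℝ}
    (h : ∀ M : Submodule ℂ H, FiniteDimensional ℂ M → ∃ x ∈ Mᗮ, c * ‖x‖ < ‖T x‖) :
    ∃ x : ℕ → H, Orthonormal ℂ x ∧ (∀ n, c < ‖T (x n)‖) ∧
      Pairwise fun m n => inner ℂ (T (x m)) (T (x n)) = 0 := by
  obtain ⟨x, hx1, hx2⟩ := exists_seq_of_forall_finset_exists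
    (fun x : H => ‖x‖ = 1 ∧ c < ‖T x‖)
    (fun x y => inner ℂ x y = 0 ∧ inner ℂ (T x) (T y) = 0) (by
      intro s _
      -- Including `star T (T z)` makes the next vector `x` satisfy `⟪T z, T x⟫ = 0`, besides `⟪z,
      -- x⟫ = 0`.
      let M : Submodule ℂ H := Submodule.span ℂ (s ∪ (fun z => star T (T z)) '' s : Set H)
      obtain ⟨x, hxM, hx⟩ := h M (FiniteDimensional.span_of_finite ℂ
        (s.finite_toSet.union (s.finite_toSet.image _)))
      have hx0 : x ≠ 0 := by
        rintro rfl
        simp at hx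
      have hpos : 0 < ‖x‖ := norm_pos_iff.mpr hx0
      have horth : ∀ z ∈ M, inner ℂ z x = 0 := fun z hz => (Submodule.mem_orthogonal _ _).mp hxM z hz
      refine ⟨((‖x‖⁻¹ : ℝ) : ℂ) • x, ⟨?_, ?_⟩, fun z hz => ⟨?_, ?_⟩⟩
      · simp [norm_smul, hpos.ne']
      · rw [map_smul, norm_smul]
        simp only [Complex.norm_real, norm_inv, norm_norm]
        rw [inv_mul_eq_div, lt_div_iff₀ hpos]
        exact hx
      · rw [inner_smul_right, horth z (Submodule.subset_span (Or.inl hz)), mul_zero]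
      · rw [map_smul, inner_smul_right]
        have := horth _ (Submodule.subset_span (Or.inr ⟨z, hz, rfl⟩))
        rw [ContinuousLinearMap.star_eq_adjoint, ContinuousLinearMap.adjoint_inner_left] at this
        rw [this, mul_zero])
  refine ⟨x, ⟨fun n => (hx1 n).1, fun m n hmn => ?_⟩, fun n => (hx1 n).2, fun m n hmn => ?_⟩
  · rcases lt_or_gt_of_ne hmn with h' | h'
    · exact (hx2 m n h').1
    · exact inner_eq_zero_symm.mp (hx2 n m h').1
  · rcases lt_or_gt_of_ne hmn with h' | h'
    · exact (hx2 m n h').2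
    · exact inner_eq_zero_symm.mp (hx2 n m h').2

/-- An operator sending the basis `e` to the orthonormal sequence `x`. -/
theorem exists_clm_basis_eq (e : HilbertBasis ℕ ℂ H) {x : ℕ → H} (hx : Orthonormal ℂ x) :
    ∃ V : H →L[ℂ] H, ∀ k, V (e k) = x k := by
  refine ⟨(hx.orthogonalFamily.linearIsometry.comp
    e.repr.toLinearIsometry).toContinuousLinearMap, fun k => ?_⟩
  simp [e.repr_self, OrthogonalFamily.linearIsometry_apply_single]

/-- An ideal containing an operator not small off any finite-dimensional subspace contains `1`. -/
theorem one_mem_of_not_small (e : HilbertBasis ℕ ℂ H) {T : H →L[ℂ] H} (hT : T ∈ J) {c : ℝ}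
    (hc : 0 < c)
    (h : ∀ M : Submodule ℂ H, FiniteDimensional ℂ M → ∃ x ∈ Mᗮ, c * ‖x‖ < ‖T x‖) :
    1 ∈ J := by
  obtain ⟨x, hx, hxc, hxT⟩ := exists_orthonormal_of_not_small h
  obtain ⟨V, hV⟩ := exists_clm_basis_eq e hx
  -- `G` lies in `J` and is diagonal with entries `‖T (x k)‖ ^ 2 > c ^ 2`; hence `G ≥ c ^ 2`, so it
  -- is invertible and `J` contains `1`.
  set G : H →L[ℂ] H := star (T * V) * (T * V) with hG
  have hGe : ∀ k, G (e k) = ((‖T (x k)‖ ^ 2 : ℝ) : ℂ) • e k := fun k => by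
    refine ext_inner_basis (e := e) fun m => ?_
    rw [hG, mul_apply_eq_comp, ContinuousLinearMap.star_eq_adjoint,
      ContinuousLinearMap.adjoint_inner_right, inner_smul_right, inner_basis]
    simp only [mul_apply_eq_comp, hV]
    by_cases hmk : m = k
    · subst hmk
      simp [inner_self_eq_norm_sq_to_K]
    · simp [hmk, hxT hmk]
  have hGsa : ∀ y z, inner ℂ (G y) z = inner ℂ y (G z) := fun y z => by
    rw [hG]
    simp [ContinuousLinearMap.star_eq_adjoint, ContinuousLinearMap.adjoint_inner_left,
      ContinuousLinearMap.adjoint_inner_right]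
  have hle : ((c ^ 2 : ℝ) • (1 : H →L[ℂ] H)) ≤ G := by
    rw [ContinuousLinearMap.le_def]
    refine ContinuousLinearMap.isPositive_def'.mpr ⟨?_, fun y => ?_⟩
    · exact (IsSelfAdjoint.star_mul_self _).sub (IsSelfAdjoint.smul (IsSelfAdjoint.all _) (.one _))
    have h1 : HasSum (fun k => ((‖T (x k)‖ ^ 2 - c ^ 2 : ℝ) * ‖inner ℂ (e k) y‖ ^ 2 : ℝ))
        (inner ℂ ((G - (c ^ 2 : ℝ) • (1 : H →L[ℂ] H)) y) y).re := by
      have h2 := e.hasSum_inner_mul_inner ((G - (c ^ 2 : ℝ) • (1 : H →L[ℂ] H)) y) y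
      have h3 := Complex.hasSum_re h2
      convert h3 using 2 with k
      have : inner ℂ ((G - (c ^ 2 : ℝ) • (1 : H →L[ℂ] H)) y) (e k)
          = ((‖T (x k)‖ ^ 2 - c ^ 2 : ℝ) : ℂ) * inner ℂ y (e k) := by
        simp only [sub_apply, inner_sub_left, hGsa, hGe, inner_smul_right]
        simp [← Complex.coe_smul, inner_smul_left, sub_mul]
      rw [this, mul_assoc, ← inner_conj_symm y (e k), ← Complex.normSq_eq_conj_mul_self,
        ← Complex.ofReal_mul, Complex.ofReal_re, Complex.normSq_eq_norm_sq]
    refine h1.nonneg fun k => mul_nonneg ?_ (sq_nonneg _)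
    nlinarith [hxc k]
  have hunit : IsUnit G := by
    refine CStarAlgebra.isUnit_of_le _ hle ?_
    exact IsStrictlyPositive.smul (by positivity) isStrictlyPositive_one
  obtain ⟨u, hu⟩ := hunit
  rw [← u.inv_mul, hu, hG]
  exact J.mul_mem_left _ _ (J.mul_mem_left _ _ (J.mul_mem_right _ _ hT))

theorem exists_finiteDimensional_small (e : HilbertBasis ℕ ℂ H) (hJ : J ≠ ⊤) {T : H →L[ℂ] H}
    (hT : T ∈ J) {c : ℝ} (hc : 0 < c) :
    ∃ M : Submodule ℂ H, FiniteDimensional ℂ M ∧ ∀ x ∈ Mᗮ, ‖T x‖ ≤ c * ‖x‖ := by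
  by_contra! h
  refine hJ (top_le_iff.mp fun x _ => ?_)
  simpa using J.mul_mem_left x 1 (one_mem_of_not_small e hT hc h)

/-- Elements of a proper ideal are compact: they are small off finitely many basis vectors. -/
theorem exists_norm_mul_one_sub_basisProj_lt (e : HilbertBasis ℕ ℂ H) (hJ : J ≠ ⊤)
    {T : H →L[ℂ] H} (hT : T ∈ J) {c : ℝ} (hc : 0 < c) (F₀ : Finset ℕ) :
    ∃ F, F₀ ⊆ F ∧ ‖T * (1 - basisProj e F)‖ < c := by
  obtain ⟨M, hM, hMT⟩ := exists_finiteDimensional_small e hJ hT (half_pos hc)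
  -- Split `T` along `M`. On `M` the strong convergence of `basisProj e F` to `1` becomes norm
  -- convergence, since only finitely many rank-one terms occur; off `M`, `T` is already small.
  have h1 : Tendsto (fun F => T * M.starProjection * (1 - basisProj e F)) atTop (𝓝 0) := by
    have h2 : ∀ F, T * M.starProjection * (1 - basisProj e F)
        = T * ∑ i, rankOne ℂ (stdOrthonormalBasis ℂ M i : H)
          ((1 - basisProj e F) (stdOrthonormalBasis ℂ M i : H)) := fun F => by
      rw [(stdOrthonormalBasis ℂ M).starProjection_eq_sum_rankOne, mul_assoc, Finset.sum_mul]
      congr 1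
      refine Finset.sum_congr rfl fun i _ => ?_
      rw [ContinuousLinearMap.mul_def, rankOne_comp, ← ContinuousLinearMap.star_eq_adjoint]
      simp [star_basisProj]
    simp_rw [h2]
    rw [← mul_zero T, ← Finset.sum_const_zero
      (s := (Finset.univ : Finset (Fin (Module.finrank ℂ M))))]
    refine tendsto_const_nhds.mul (tendsto_finsetSum _ fun i _ => ?_)
    have h3 : Tendsto (fun F => (1 - basisProj e F) (stdOrthonormalBasis ℂ M i : H)) atTop
        (𝓝 0) := by
      simpa using (tendsto_const_nhds (x := (stdOrthonormalBasis ℂ M i : H))).sub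
        (tendsto_basisProj_apply e (stdOrthonormalBasis ℂ M i : H))
    have h4 := ((rankOne ℂ (stdOrthonormalBasis ℂ M i : H)).continuous.tendsto 0).comp h3
    rw [map_zero] at h4
    exact h4
  obtain ⟨F, hF, hF0⟩ := ((h1.norm.eventually_lt_const (norm_zero.trans_lt (half_pos hc))).and
    (eventually_ge_atTop F₀)).exists
  refine ⟨F, hF0, ?_⟩
  have h4 : ‖T * (1 - M.starProjection)‖ ≤ c / 2 := by
    refine ContinuousLinearMap.opNorm_le_bound _ (half_pos hc).le fun x => ?_
    have hx : (1 - M.starProjection) x ∈ Mᗮ := by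
      simp [M.sub_starProjection_mem_orthogonal x]
    refine (hMT _ hx).trans ?_
    gcongr
    have : (1 - M.starProjection) x = Mᗮ.starProjection x := by
      simp [Submodule.starProjection_orthogonal']
    rw [this]
    exact Submodule.norm_starProjection_apply_le _ _
  have h5 : ‖1 - basisProj e F‖ ≤ 1 :=
    IsStarProjection.norm_le _ (by
      refine IsStarProjection.one_sub ⟨basisProj_mul_self e F, star_basisProj e F⟩)
  calc ‖T * (1 - basisProj e F)‖
      = ‖T * M.starProjection * (1 - basisProj e F)
          + T * (1 - M.starProjection) * (1 - basisProj e F)‖ := by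
        congr 1
        noncomm_ring
    _ ≤ ‖T * M.starProjection * (1 - basisProj e F)‖
          + ‖T * (1 - M.starProjection) * (1 - basisProj e F)‖ := norm_add_le _ _
    _ < c / 2 + c / 2 * 1 := by
        refine add_lt_add_of_lt_of_le hF ((norm_mul_le _ _).trans ?_)
        gcongr
    _ = c := by ring

end CompactIdeal

/-! ### Spectral resolutions, and the diagonal projections obtained from a diagonalizing unitary. -/

section Resolution

variable {H : Type*} [NormedAddCommGroup H] [InnerProductSpace ℂ H] [CompleteSpace H]

/-- The projections `P n` form a resolution of the identity reducing `A` to the scalars `lam n`. -/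
structure IsSpectralResolution {N : ℕ} (A : H →L[ℂ] H) (lam : Fin N → ℂ)
    (P : Fin N → (H →L[ℂ] H)) : Prop where
  isStarProjection : ∀ n, IsStarProjection (P n)
  mul_eq_zero : ∀ m n, m ≠ n → P m * P n = 0
  sum_eq_one : ∑ n, P n = 1
  mul_left : ∀ n, A * P n = lam n • P n
  mul_right : ∀ n, P n * A = lam n • P n

/-- Every function is continuous on a finite spectrum, so the continuous functional calculus applies
to the indicators of the points. The relations hold pointwise for the resulting `R n`, and `R n` is
then identified with the projection onto the eigenspace. -/
theorem isSpectralResolution_spectralProjection {A : H →L[ℂ] H} (hA : IsStarNormal A)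
    {N : ℕ} {lam : Fin N → ℂ} (hlam : Function.Injective lam)
    (hspec : Set.range lam = spectrum ℂ A) :
    IsSpectralResolution A lam fun n => spectralProjection A (lam n) := by
  classical
  have hfin : (spectrum ℂ A).Finite := hspec ▸ Set.finite_range lam
  have hc : ∀ f : ℂ → ℂ, ContinuousOn f (spectrum ℂ A) := fun f => hfin.continuousOn f
  let φ : Fin N → ℂ → ℂ := fun n z => if z = lam n then 1 else 0
  let R : Fin N → (H →L[ℂ] H) := fun n => cfc (φ n) A
  have hA_left : ∀ n, A * R n = lam n • R n := fun n => by
    rw [← cfc_const_mul (lam n) (φ n) A (hc _)]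
    conv_lhs => rw [← cfc_id ℂ A]
    rw [← cfc_mul _ _ _ (hc _) (hc _)]
    refine cfc_congr fun z _ => ?_
    by_cases h : z = lam n <;> simp [φ, h]
  have hA_right : ∀ n, R n * A = lam n • R n := fun n => by
    have h := cfc_commute_cfc (φ n) id A
    rw [cfc_id ℂ A] at h
    exact h.eq.trans (hA_left n)
  have hR_mul : ∀ m n, R m * R n = if m = n then R n else 0 := fun m n => by
    rw [← cfc_mul _ _ _ (hc _) (hc _)]
    split_ifs with h
    · subst h
      exact cfc_congr fun z _ => by simp [φ]
    · rw [← cfc_const_zero ℂ A]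
      refine cfc_congr fun z _ => ?_
      have := hlam.ne h
      simp only [φ]
      split_ifs <;> simp_all
  have hR_star : ∀ n, IsSelfAdjoint (R n) := fun n => by
    rw [IsSelfAdjoint, ← cfc_star]
    refine cfc_congr fun z _ => ?_
    simp only [φ]
    split_ifs <;> simp
  have hR_sum : ∑ n, R n = 1 := by
    rw [← cfc_sum_univ φ A fun _ => hc _, ← cfc_one ℂ A]
    refine cfc_congr fun z hz => ?_
    obtain ⟨m, rfl⟩ := hspec.symm ▸ hz
    simp [φ, hlam.eq_iff]
  have hP : ∀ n, spectralProjection A (lam n) = R n := fun n => by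
    have hPs : IsStarProjection (spectralProjection A (lam n)) := isStarProjection_starProjection
    have h1 : spectralProjection A (lam n) * R n = R n := by
      ext x
      refine Submodule.starProjection_eq_self_iff.mpr ?_
      have := congrArg (fun T : H →L[ℂ] H => T x) (hA_left n)
      simpa [sub_eq_zero] using this
    have h2 : R n * spectralProjection A (lam n) = spectralProjection A (lam n) := by
      ext x
      set v := spectralProjection A (lam n) x with hv
      have hAv : A v = lam n • v := by
        have : v ∈ (A - lam n • (1 : H →L[ℂ] H)).ker := by
          rw [hv]
          exact Submodule.starProjection_apply_mem _ _
        simpa [sub_eq_zero] using this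
      have hm : ∀ m, m ≠ n → R m v = 0 := fun m hmn => by
        have h3 := congrArg (fun T : H →L[ℂ] H => T v) (hA_right m)
        simp only [mul_apply_eq_comp, smul_apply, hAv, map_smul] at h3
        rw [← sub_eq_zero, ← sub_smul] at h3
        exact (smul_eq_zero.mp h3).resolve_left (sub_ne_zero.mpr (hlam.ne hmn.symm))
      have h4 := congrArg (fun T : H →L[ℂ] H => T v) hR_sum
      simp only [sum_apply, one_apply_eq_self] at h4
      rwa [Finset.sum_eq_single n (fun m _ => hm m) (by simp)] at h4
    have h3 := congrArg star h2
    rw [star_mul, hPs.2.star_eq, (hR_star n).star_eq] at h3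
    exact h3.symm.trans h1
  simp_rw [hP]
  refine ⟨fun n => ⟨?_, hR_star n⟩, fun m n h => ?_, hR_sum, hA_left, hA_right⟩
  · simpa [IsIdempotentElem] using hR_mul n n
  · simpa [h] using hR_mul m n

variable {N : ℕ} {A : H →L[ℂ] H} {lam : Fin N → ℂ} {P : Fin N → (H →L[ℂ] H)}
  {J : TwoSidedIdeal (H →L[ℂ] H)} {e : HilbertBasis ℕ ℂ H}

omit [CompleteSpace H] in
theorem sum_mem_of_forall_sub_mem {E : Fin N → (H →L[ℂ] H)}
    (hE : ∀ n, IsIdempotentElem (E n)) (hP : ∀ n, IsIdempotentElem (P n))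
    (h : ∀ n, E n - P n ∈ J) :
    ∑ n, (1 - E n) * P n ∈ J ∧ ∑ n, E n * (1 - P n) ∈ J := by
  refine ⟨sum_mem fun n _ => ?_, sum_mem fun n _ => ?_⟩
  · have : (1 - E n) * P n = -((E n - P n) * P n) := by
      rw [sub_mul, sub_mul, (hP n).eq]; simp
    rw [this]
    exact J.neg_mem (J.mul_mem_right _ _ (h n))
  · have : E n * (1 - P n) = E n * (E n - P n) := by
      rw [mul_sub, mul_sub, (hE n).eq]; simp
    rw [this]
    exact J.mul_mem_left _ _ (h n)

/-- Unitarity gives this directly, without knowing that `J` is closed under adjoints. -/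
theorem sub_one_mem_of_unitary {U : H →L[ℂ] H} (hU : U ∈ unitary (H →L[ℂ] H)) (h : U - 1 ∈ J) :
    star U - 1 ∈ J := by
  have : star U - 1 = -(star U * (U - 1)) := by
    rw [mul_sub, Unitary.star_mul_self_of_mem hU]
    simp
  rw [this]
  exact J.neg_mem (J.mul_mem_left _ _ h)

namespace IsSpectralResolution

theorem apply_eq_smul (h : IsSpectralResolution A lam P) {n : Fin N} {v : H} (hv : P n v = v) :
    A v = lam n • v := by
  have := congrArg (fun T : H →L[ℂ] H => T v) (h.mul_left n)
  simpa [hv] using this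

/-- An eigenvector for `d` is killed by every `P m` with `lam m ≠ d`. As the `lam m` are distinct,
either `P n` kills it or all other projections do. -/
theorem exists_apply_eq_smul (h : IsSpectralResolution A lam P) (hlam : Function.Injective lam)
    {v : H} {d : ℂ} (hv : A v = d • v) (n : Fin N) : ∃ c : ℂ, P n v = c • v := by
  have key : ∀ m, d ≠ lam m → P m v = 0 := fun m hm => by
    have h3 := congrArg (fun T : H →L[ℂ] H => T v) (h.mul_right m)
    simp only [mul_apply_eq_comp, smul_apply, hv, map_smul] at h3
    rw [← sub_eq_zero, ← sub_smul] at h3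
    exact (smul_eq_zero.mp h3).resolve_left (sub_ne_zero.mpr hm)
  by_cases hd : d = lam n
  · refine ⟨1, ?_⟩
    have h4 := congrArg (fun T : H →L[ℂ] H => T v) h.sum_eq_one
    simp only [sum_apply, one_apply_eq_self] at h4
    rw [Finset.sum_eq_single n (fun m _ hm => key m (hd ▸ hlam.ne hm.symm)) (by simp)] at h4
    rw [h4, one_smul]
  · exact ⟨0, by rw [key n hd, zero_smul]⟩

theorem exists_diagonalProjection (h : IsSpectralResolution A lam P)
    (hlam : Function.Injective lam) (hA : IsRestrictedDiagonalizable e J A) :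
    ∃ E : Fin N → (H →L[ℂ] H), (∀ n, IsDiagonalProjection e (E n)) ∧ ∀ n, E n - P n ∈ J := by
  obtain ⟨U, ⟨hU, hUJ⟩, hD⟩ := hA
  have hU1 := Unitary.star_mul_self_of_mem hU
  have hU2 := Unitary.mul_star_self_of_mem hU
  have hU2' : ∀ x, U (star U x) = x := fun x => by
    simpa using congrArg (fun T : H →L[ℂ] H => T x) hU2
  have hU1' : ∀ x, star U (U x) = x := fun x => by
    simpa using congrArg (fun T : H →L[ℂ] H => T x) hU1
  refine ⟨fun n => U * P n * star U, fun n => ⟨⟨?_, ?_⟩, ?_⟩, fun n => ?_⟩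
  · calc U * P n * star U * (U * P n * star U) = U * P n * (star U * U) * P n * star U := by
          noncomm_ring
      _ = U * (P n * P n) * star U := by rw [hU1]; noncomm_ring
      _ = _ := by rw [(h.isStarProjection n).1.eq]
  · exact (h.isStarProjection n).2.conjugate U
  · refine isDiagonal_of_apply_eq_smul fun k => ?_
    obtain ⟨d, hd⟩ := hD.exists_apply_eq_smul k
    have hv : A (star U (e k)) = d • star U (e k) := by
      rw [← map_smul, ← hd]
      simp [hU1']
    obtain ⟨c, hc⟩ := h.exists_apply_eq_smul hlam hv n
    exact ⟨c, by simp [hc, hU2']⟩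
  · have : U * P n * star U - P n = (U - 1) * P n * star U + P n * (star U - 1) := by
      noncomm_ring
    rw [this]
    exact J.add_mem (J.mul_mem_right _ _ (J.mul_mem_right _ _ hUJ))
      (J.mul_mem_left _ _ (sub_one_mem_of_unitary hU hUJ))

end IsSpectralResolution

end Resolution

/-! ### The polar factor, the dimension of the defect space, and adapted orthonormal bases. -/

section AdaptedBasis

/-- The inverse square root `S` of `Y⋆Y + (1 - Q)`, where `Y` is close to the projection `Q`. -/
theorem exists_inv_sqrt {R : Type*} [CStarAlgebra R] [PartialOrder R] [StarOrderedRing R]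
    {J : TwoSidedIdeal R} {Q Y : R} (hQ : IsStarProjection Q) (hYQ : Y * Q = Y)
    (hY : ‖Y - Q‖ < 1 / 4) (hYJ : Y - Q ∈ J) (hYJ' : star Y - Q ∈ J) :
    ∃ S : R, IsUnit S ∧ IsSelfAdjoint S ∧ S - 1 ∈ J ∧ Commute S Q ∧
      (∀ X, Commute (star Y * Y) X → Commute Q X → Commute S X) ∧
      star (Y * S * Q) * (Y * S * Q) = Q := by
  set T := star Y * Y + (1 - Q) with hT
  have hQsa : star Q = Q := hQ.2.star_eq
  have hQQ : Q * Q = Q := hQ.1.eq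
  have hQY : Q * star Y = star Y := by
    rw [← hQsa, ← star_mul, hYQ]
  have hT1 : T - 1 = (star Y - Q) * Y + Q * (Y - Q) := by
    rw [hT, mul_sub, sub_mul, hQQ]; abel
  have hT0 : 0 ≤ T := add_nonneg (star_mul_self_nonneg Y) hQ.one_sub.nonneg
  have hQn : ‖Q‖ ≤ 1 := hQ.norm_le
  have hYn : ‖Y‖ ≤ 5 / 4 := by
    calc ‖Y‖ = ‖(Y - Q) + Q‖ := by rw [sub_add_cancel]
      _ ≤ ‖Y - Q‖ + ‖Q‖ := norm_add_le _ _
      _ ≤ 5 / 4 := by linarith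
  have hYs : ‖star Y - Q‖ < 1 / 4 := by
    rwa [← hQsa, ← star_sub, norm_star]
  have hTn : ‖1 - T‖ < 1 := by
    rw [norm_sub_rev, hT1]
    calc _ ≤ ‖star Y - Q‖ * ‖Y‖ + ‖Q‖ * ‖Y - Q‖ :=
          (norm_add_le _ _).trans (add_le_add (norm_mul_le _ _) (norm_mul_le _ _))
      -- The total is `9/16`, so the bound `1/4` on `‖Y - Q‖` makes `T` invertible by a Neumann
      -- series.
      _ ≤ 1 / 4 * (5 / 4) + 1 * (1 / 4) := by gcongr
      _ < 1 := by norm_num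
  have hTu : IsUnit T := by
    have := (Units.oneSub (1 - T) hTn).isUnit
    simpa using this
  set C := CFC.sqrt T with hC
  have hCC : C * C = T := CFC.sqrt_mul_sqrt_self T hT0
  have hC0 : 0 ≤ C := CFC.sqrt_nonneg T
  have hCcomm : ∀ X, Commute T X → Commute C X := fun X hX => by
    rw [hC, CFC.sqrt_eq_cfc]
    exact hX.cfc_nnreal _
  have hCu : IsUnit C := by
    have : IsUnit (C * C) := hCC.symm ▸ hTu
    exact ((Commute.refl C).isUnit_mul_iff.mp this).1
  obtain ⟨u, hu⟩ := hCu
  have hTcomm : ∀ X, Commute (star Y * Y) X → Commute Q X → Commute T X := fun X h1 h2 =>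
    h1.add_left ((Commute.one_left X).sub_left h2)
  have hScomm : ∀ X, Commute (star Y * Y) X → Commute Q X → Commute (↑u⁻¹ : R) X :=
    fun X h1 h2 => Commute.units_inv_left (hu.symm ▸ hCcomm X (hTcomm X h1 h2))
  have hSQ : Commute (↑u⁻¹ : R) Q := by
    refine hScomm Q ?_ (Commute.refl Q)
    change star Y * Y * Q = Q * (star Y * Y)
    rw [mul_assoc, hYQ, ← mul_assoc, hQY]
  have hSsa : IsSelfAdjoint (↑u⁻¹ : R) := by
    have : star u = u := Units.ext (by simpa [hu] using hC0.isSelfAdjoint.star_eq)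
    change star (↑u⁻¹ : R) = _
    rw [← Units.coe_star_inv, this]
  refine ⟨↑u⁻¹, u⁻¹.isUnit, hSsa, ?_, hSQ, hScomm, ?_⟩
  · have h1C : IsUnit (1 + C) :=
      CStarAlgebra.isUnit_of_le 1 (le_add_of_nonneg_right hC0) isStrictlyPositive_one
    obtain ⟨w, hw⟩ := h1C
    have hTJ : T - 1 ∈ J := hT1 ▸ J.add_mem (J.mul_mem_right _ _ hYJ') (J.mul_mem_left _ _ hYJ)
    have hCJ : C - 1 ∈ J := by
      -- From `C ^ 2 - 1 = (C - 1) * (C + 1)`: the square root stays in `1 + J` by algebra, so `J`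
      -- need not be norm closed.
      have : C - 1 = (T - 1) * ↑w⁻¹ := by
        rw [Units.eq_mul_inv_iff_mul_eq, hw, ← hCC]
        noncomm_ring
      rw [this]
      exact J.mul_mem_right _ _ hTJ
    have : (↑u⁻¹ : R) - 1 = -((C - 1) * ↑u⁻¹) := by
      rw [sub_mul, ← hu, u.mul_inv]; simp
    rw [this]
    exact J.neg_mem (J.mul_mem_right _ _ hCJ)
  · have hSTS : (↑u⁻¹ : R) * T * ↑u⁻¹ = 1 := by
      rw [← hCC, ← hu, ← mul_assoc, u.inv_mul, one_mul, u.mul_inv]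
    rw [star_mul, star_mul, hQsa, hSsa.star_eq]
    -- Replace `star Y * Y` by `T - (1 - Q)`; the correction vanishes because the inverse root
    -- commutes with `Q`.
    calc Q * (↑u⁻¹ * star Y) * (Y * ↑u⁻¹ * Q)
        = Q * (↑u⁻¹ * T * ↑u⁻¹) * Q - Q * ↑u⁻¹ * (1 - Q) * (↑u⁻¹ * Q) := by
          rw [hT]; noncomm_ring
      _ = Q := by
          rw [hSTS, mul_one, hQQ, hSQ.eq]
          have : (1 - Q) * (Q * (↑u⁻¹ : R)) = 0 := by
            rw [← mul_assoc, sub_mul, hQQ, one_mul, sub_self, zero_mul]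
          rw [mul_assoc _ (1 - Q), this, mul_zero, sub_zero]

variable {H : Type*} [NormedAddCommGroup H] [InnerProductSpace ℂ H]

/-- The invertible sum maps the kernel of `X` onto the range of `basisProj e F`: if `X y + B y = B
x`, with `B` the projection, applying `B` gives `B y = B x`, hence `X y = 0`. -/
theorem finrank_ker_of_isUnit_add {e : HilbertBasis ℕ ℂ H} {F : Finset ℕ} {X : H →L[ℂ] H}
    (hX : basisProj e F * X = 0) (hu : IsUnit (X + basisProj e F)) :
    FiniteDimensional ℂ X.ker ∧ Module.finrank ℂ X.ker = F.card := by
  obtain ⟨u, hu⟩ := hu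
  let φ : H ≃ₗ[ℂ] H := (ContinuousLinearEquiv.unitsEquiv ℂ H u).toLinearEquiv
  have hφ : ∀ x, φ x = X x + basisProj e F x := fun x => by
    change (u : H →L[ℂ] H) x = _
    rw [hu]; rfl
  have hBX : ∀ x, basisProj e F (X x) = 0 := fun x => by
    simpa using congrArg (fun T : H →L[ℂ] H => T x) hX
  have hBB : ∀ x, basisProj e F (basisProj e F x) = basisProj e F x := fun x => by
    simpa using congrArg (fun T : H →L[ℂ] H => T x) (basisProj_mul_self e F)
  have hmap : X.ker.map (φ : H →ₗ[ℂ] H) = (basisProj e F).range := by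
    ext v
    constructor
    · rintro ⟨y, hy, rfl⟩
      have hy' : X y = 0 := hy
      exact ⟨y, by simp [hφ, hy']⟩
    · rintro ⟨x, rfl⟩
      refine ⟨φ.symm (basisProj e F x), ?_, by simp⟩
      set y := φ.symm (basisProj e F x)
      have h1 : X y + basisProj e F y = basisProj e F x := by
        rw [← hφ]; simp [y]
      have h2 := congrArg (basisProj e F) h1
      rw [map_add, hBX, hBB, hBB, zero_add] at h2
      change X y = 0
      rwa [h2, add_eq_right] at h1
  obtain ⟨h1, h2⟩ := finrank_range_basisProj e F
  rw [← hmap] at h1 h2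
  exact ⟨(φ.submoduleMap X.ker).symm.finiteDimensional,
    (φ.submoduleMap X.ker).finrank_eq.trans h2⟩

variable [CompleteSpace H]

variable {N : ℕ} {A : H →L[ℂ] H} {lam : Fin N → ℂ} {P : Fin N → (H →L[ℂ] H)}
  {J : TwoSidedIdeal (H →L[ℂ] H)} {e : HilbertBasis ℕ ℂ H}

namespace IsSpectralResolution

/-- An invariant finite-dimensional subspace has an orthonormal basis adapted to the `P n`. -/
theorem exists_orthonormalBasis (h : IsSpectralResolution A lam P) {K : Submodule ℂ H}
    [FiniteDimensional ℂ K] (hK : ∀ n, ∀ x ∈ K, P n x ∈ K) {m : ℕ}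
    (hm : Module.finrank ℂ K = m) :
    ∃ b : OrthonormalBasis (Fin m) ℂ K, ∀ i, ∃ n, P n (b i) = b i := by
  have hLK : ∀ x ∈ K, (∑ n : Fin N, ((n : ℕ) : ℝ) • P n) x ∈ K := fun x hx => by
    rw [sum_apply]
    exact Submodule.sum_mem _ fun n _ => K.smul_of_tower_mem _ (hK n x hx)
  -- Weighting the `P n` by distinct reals gives a self-adjoint operator, so the finite-dimensional
  -- spectral theorem for symmetric maps applies; each of its eigenvectors lies in the range of a
  -- single `P n`.
  have hLs : IsSelfAdjoint (∑ n : Fin N, ((n : ℕ) : ℝ) • P n) :=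
    isSelfAdjoint_sum _ fun n _ => (IsSelfAdjoint.all _).smul (h.isStarProjection n).2
  set L := ∑ n : Fin N, ((n : ℕ) : ℝ) • P n with hL
  have hsymm : ((L : H →ₗ[ℂ] H).restrict hLK).IsSymmetric :=
    hLs.isSymmetric.restrict_invariant hLK
  refine ⟨hsymm.eigenvectorBasis hm, fun i => ?_⟩
  set v : H := (hsymm.eigenvectorBasis hm i : H) with hv
  set μ := hsymm.eigenvalues hm i
  have hLv : L v = μ • v := by
    have h1 : L v = (μ : ℂ) • v := congrArg Subtype.val (hsymm.apply_eigenvectorBasis hm i)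
    rw [h1, Complex.coe_smul]
  have hPL : ∀ n, P n * L = ((n : ℕ) : ℝ) • P n := fun n => by
    rw [hL, Finset.mul_sum, Finset.sum_eq_single n]
    · rw [mul_smul_comm, (h.isStarProjection n).1.eq]
    · intro k _ hk
      rw [mul_smul_comm, h.mul_eq_zero n k hk.symm, smul_zero]
    · simp
  have hz : ∀ n : Fin N, ((n : ℕ) : ℝ) ≠ μ → P n v = 0 := fun n hn => by
    have h1 := congrArg (fun T : H →L[ℂ] H => T v) (hPL n)
    simp only [mul_apply_eq_comp, smul_apply, hLv] at h1
    rw [← Complex.coe_smul, map_smul, Complex.coe_smul, ← sub_eq_zero, ← sub_smul] at h1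
    exact (smul_eq_zero.mp h1).resolve_left (sub_ne_zero.mpr hn.symm)
  have hsum : ∑ n, P n v = v := by
    simpa using congrArg (fun T : H →L[ℂ] H => T v) h.sum_eq_one
  have hv0 : v ≠ 0 := by
    have := (hsymm.eigenvectorBasis hm).orthonormal.ne_zero i
    simpa [hv] using this
  obtain ⟨n, -, hn⟩ := Finset.exists_ne_zero_of_sum_ne_zero (hsum.symm ▸ hv0)
  have hnμ : ((n : ℕ) : ℝ) = μ := by
    by_contra hne
    exact hn (hz n hne)
  refine ⟨n, ?_⟩
  rwa [Finset.sum_eq_single n (fun k _ hk => hz k fun h' => hk (Fin.ext (by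
    exact_mod_cast h'.trans hnμ.symm))) (by simp)] at hsum

end IsSpectralResolution

end AdaptedBasis

/-! ### From diagonal projections to the diagonalizing unitary. -/

section Construction

variable {H : Type*} [NormedAddCommGroup H] [InnerProductSpace ℂ H] [CompleteSpace H]
variable {N : ℕ} {A : H →L[ℂ] H} {lam : Fin N → ℂ} {P E : Fin N → (H →L[ℂ] H)}
  {J : TwoSidedIdeal (H →L[ℂ] H)} {e : HilbertBasis ℕ ℂ H}

theorem IsDiagonalProjection.apply_basis {D : H →L[ℂ] H} (hD : IsDiagonalProjection e D) (k : ℕ) :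
    D (e k) = 0 ∨ D (e k) = e k := by
  obtain ⟨c, hc⟩ := hD.2.exists_apply_eq_smul k
  have h := congrArg (fun T : H →L[ℂ] H => T (e k)) hD.1.1.eq
  simp only [mul_apply_eq_comp, hc, map_smul, smul_smul] at h
  rw [← sub_eq_zero, ← sub_smul, smul_eq_zero, or_iff_left (e.orthonormal.ne_zero k)] at h
  have : c * (c - 1) = 0 := by linear_combination h
  rcases mul_eq_zero.mp this with h0 | h1
  · left; rw [hc, h0, zero_smul]
  · right; rw [hc, sub_eq_zero.mp h1, one_smul]

/-- Diagonal projections whose sum is `1` modulo `J` eventually partition the basis. -/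
theorem exists_partition_of_sum_sub_one_mem (hJ : J ≠ ⊤) (hE : ∀ n, IsDiagonalProjection e (E n))
    (h : ∑ n, E n - 1 ∈ J) :
    ∃ F₀ : Finset ℕ, ∀ k ∉ F₀, ∃ n, E n (e k) = e k ∧ ∀ m, m ≠ n → E m (e k) = 0 := by
  classical
  obtain ⟨F, -, hF⟩ := exists_norm_mul_one_sub_basisProj_lt e hJ h one_pos ∅
  refine ⟨F, fun k hk => ?_⟩
  set S := Finset.univ.filter fun n => E n (e k) = e k with hS
  -- Each `E n` acts on `e k` as `0` or `1`, so the eigenvalue here is an integer; the norm bound `<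
  -- 1` forces it to be `0`.
  have hsum : ((∑ n, E n - 1) * (1 - basisProj e F)) (e k) = ((S.card : ℂ) - 1) • e k := by
    have h1 : ∀ n, E n (e k) = if E n (e k) = e k then e k else 0 := fun n => by
      split_ifs with hn
      · exact hn
      · exact ((hE n).apply_basis k).resolve_right hn
    have h2 : ∑ n, E n (e k) = (S.card : ℂ) • e k := by
      rw [Finset.sum_congr rfl fun n _ => h1 n, ← Finset.sum_filter, Finset.sum_const,
        Nat.cast_smul_eq_nsmul]
    simp only [mul_apply_eq_comp, sub_apply, one_apply_eq_self, basisProj_basis, if_neg hk,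
      sub_zero, sum_apply, h2, sub_smul, one_smul]
  have hnorm : ‖((S.card : ℂ) - 1)‖ < 1 := by
    have h3 := ((∑ n, E n - 1) * (1 - basisProj e F)).le_opNorm (e k)
    rw [hsum, norm_smul, e.orthonormal.1 k, mul_one, mul_one] at h3
    exact h3.trans_lt hF
  have hcard : S.card = 1 := by
    have h4 : |((S.card : ℤ) : ℝ) - 1| < 1 := by
      rw [← Real.norm_eq_abs, ← Complex.norm_real]
      simpa using hnorm
    have h5 : |(S.card : ℤ) - 1| < 1 := by exact_mod_cast h4
    have := Int.abs_lt_one_iff.mp h5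
    omega
  obtain ⟨n, hn⟩ := Finset.card_eq_one.mp hcard
  have hmem : ∀ m, E m (e k) = e k ↔ m = n := fun m => by
    rw [← Finset.mem_singleton (a := n), ← hn, hS]; simp
  exact ⟨n, (hmem n).mpr rfl, fun m hm =>
    ((hE m).apply_basis k).resolve_right fun h' => hm ((hmem m).mp h')⟩

namespace IsSpectralResolution

theorem exists_partition (h : IsSpectralResolution A lam P) (hJ : IsProperIdeal J)
    (hE : ∀ n, IsDiagonalProjection e (E n))
    (h1 : ∑ n, (1 - E n) * P n ∈ J) (h2 : ∑ n, E n * (1 - P n) ∈ J) :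
    (∀ n, E n - P n ∈ J) ∧
    ∃ F₀ : Finset ℕ, ∀ k ∉ F₀, ∃ n, E n (e k) = e k ∧ ∀ m, m ≠ n → E m (e k) = 0 := by
  have hsum : ∑ n, E n - 1 ∈ J := by
    have : ∑ n, E n - 1 = ∑ n, E n * (1 - P n) - ∑ n, (1 - E n) * P n := by
      conv_lhs => rw [← h.sum_eq_one]
      rw [← Finset.sum_sub_distrib, ← Finset.sum_sub_distrib]
      refine Finset.sum_congr rfl fun n _ => ?_
      rw [mul_sub, sub_mul, mul_one, one_mul]
      abel
    rw [this]
    exact J.sub_mem h2 h1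
  obtain ⟨F₀, hF₀⟩ := exists_partition_of_sum_sub_one_mem hJ.2 hE hsum
  refine ⟨fun m => ?_, F₀, hF₀⟩
  have h3 : ∀ n, (1 - E n) * P n ∈ J := fun n => by
    have : (1 - E n) * P n = (∑ k, (1 - E k) * P k) * P n := by
      rw [Finset.sum_mul, Finset.sum_eq_single n]
      · rw [mul_assoc, (h.isStarProjection n).1.eq]
      · intro k _ hk
        rw [mul_assoc, h.mul_eq_zero k n hk, mul_zero]
      · simp
    rw [this]
    exact J.mul_mem_right _ _ h1
  -- The product vanishes on `e k` for `k ∉ F₀`, so it has finite rank.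
  have h4 : ∀ n, m ≠ n → E m * E n ∈ J := fun n hmn => by
    have : E m * E n = E m * E n * basisProj e F₀ := by
      refine clm_ext_basis (e := e) fun k => ?_
      simp only [mul_apply_eq_comp, basisProj_basis]
      split_ifs with hk
      · rfl
      · obtain ⟨l, hl, hl'⟩ := hF₀ k hk
        by_cases hnl : n = l
        · subst hnl
          simp [hl, hl' m hmn]
        · simp [hl' n hnl]
    rw [this]
    exact J.mul_mem_left _ _ (basisProj_mem hJ.1 e F₀)
  have h5 : ∀ n, m ≠ n → E m * P n ∈ J := fun n hmn => by
    have : E m * P n = E m * ((1 - E n) * P n) + E m * E n * P n := by noncomm_ring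
    rw [this]
    exact J.add_mem (J.mul_mem_left _ _ (h3 n)) (J.mul_mem_right _ _ (h4 n hmn))
  have : E m - P m = ∑ n ∈ Finset.univ.erase m, E m * P n - (1 - E m) * P m := by
    have h6 : E m = E m * ∑ n, P n := by rw [h.sum_eq_one, mul_one]
    rw [Finset.mul_sum, ← Finset.add_sum_erase _ _ (Finset.mem_univ m)] at h6
    rw [sub_mul, one_mul]
    conv_lhs => rw [h6]
    abel
  rw [this]
  exact J.sub_mem (sum_mem fun n hn => h5 n (Finset.ne_of_mem_erase hn).symm) (h3 m)

theorem isRestrictedDiagonalizable (h : IsSpectralResolution A lam P) (hJ : IsProperIdeal J)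
    (hE : ∀ n, IsDiagonalProjection e (E n)) (hEP : ∀ n, E n - P n ∈ J) {F₀ : Finset ℕ}
    (hF₀ : ∀ k ∉ F₀, ∃ n, E n (e k) = e k ∧ ∀ m, m ≠ n → E m (e k) = 0) :
    IsRestrictedDiagonalizable e J A := by
  classical
  have hXJ : ∑ n, P n * E n - 1 ∈ J := by
    have : ∑ n, P n * E n - 1 = ∑ n, P n * (E n - P n) := by
      rw [← h.sum_eq_one, ← Finset.sum_sub_distrib]
      exact Finset.sum_congr rfl fun n _ => by rw [mul_sub, (h.isStarProjection n).1.eq]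
    rw [this]
    exact sum_mem fun n _ => J.mul_mem_left _ _ (hEP n)
  -- This is the adjoint of the previous membership, proved separately since closure of `J` under
  -- `star` is not available here.
  have hXJ' : ∑ n, E n * P n - 1 ∈ J := by
    have : ∑ n, E n * P n - 1 = ∑ n, (E n - P n) * P n := by
      rw [← h.sum_eq_one, ← Finset.sum_sub_distrib]
      exact Finset.sum_congr rfl fun n _ => by rw [sub_mul, (h.isStarProjection n).1.eq]
    rw [this]
    exact sum_mem fun n _ => J.mul_mem_right _ _ (hEP n)
  obtain ⟨F, hF, hFn⟩ := exists_norm_mul_one_sub_basisProj_lt e hJ.2 hXJ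
    (c := 1 / 4) (by norm_num) F₀
  set B := basisProj e F with hB
  have hBp : IsStarProjection B := ⟨basisProj_mul_self e F, star_basisProj e F⟩
  set Q := 1 - B with hQdef
  have hQ : IsStarProjection Q := hBp.one_sub
  clear_value Q
  have hQQ : Q * Q = Q := hQ.1.eq
  have hQs : star Q = Q := hQ.2.star_eq
  have hQe : ∀ k, Q (e k) = if k ∈ F then 0 else e k := fun k => by
    simp only [hQdef, sub_apply, one_apply_eq_self, hB, basisProj_basis]
    split_ifs <;> simp
  have hEs : ∀ n, star (E n) = E n := fun n => (hE n).1.2.star_eq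
  have hPs : ∀ n, star (P n) = P n := fun n => (h.isStarProjection n).2.star_eq
  have hEQ : ∀ n, E n * Q = Q * E n := fun n => by
    refine clm_ext_basis (e := e) fun k => ?_
    rcases (hE n).apply_basis k with hk | hk <;> by_cases hkF : k ∈ F <;> simp [hQe, hk, hkF]
  have hEEQ : ∀ m n, E m * (E n * Q) = if m = n then E n * Q else 0 := fun m n => by
    split_ifs with hmn
    · rw [hmn, ← mul_assoc, (hE n).1.1.eq]
    · refine clm_ext_basis (e := e) fun k => ?_
      by_cases hkF : k ∈ F
      · simp [hQe, hkF]
      · obtain ⟨l, hl, hl'⟩ := hF₀ k fun hk => hkF (hF hk)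
        by_cases hnl : n = l
        · subst hnl
          simp [hQe, hkF, hl, hl' m hmn]
        · simp [hQe, hkF, hl' n hnl]
  set Y := (∑ n, P n * E n) * Q with hY
  clear_value Y
  have hYQ : Y * Q = Y := by rw [hY, mul_assoc, hQQ]
  have hYQ' : Y - Q = (∑ n, P n * E n - 1) * Q := by rw [hY, sub_mul, one_mul]
  have hYs : star Y = Q * ∑ n, E n * P n := by
    rw [hY, star_mul, hQs, star_sum]
    simp_rw [star_mul, hEs, hPs]
  have hYJ : Y - Q ∈ J := hYQ' ▸ J.mul_mem_right _ _ hXJ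
  have hYJ' : star Y - Q ∈ J := by
    have : star Y - Q = Q * (∑ n, E n * P n - 1) := by rw [hYs, mul_sub, mul_one]
    exact this ▸ J.mul_mem_left _ _ hXJ'
  have hYn : ‖Y - Q‖ < 1 / 4 := hYQ' ▸ hFn
  -- With `hYE` this gives `P n * Y = Y * (E n * Q)`. Hence `star Y * Y` commutes with `E n * Q`, so
  -- does `S`, and the intertwining passes to `W`.
  have hPY : ∀ n, P n * Y = P n * (E n * Q) := fun n => by
    rw [hY, ← mul_assoc, Finset.mul_sum, Finset.sum_eq_single n]
    · rw [← mul_assoc, (h.isStarProjection n).1.eq, mul_assoc]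
    · intro k _ hk
      rw [← mul_assoc, h.mul_eq_zero n k hk.symm, zero_mul]
    · simp
  have hYE : ∀ n, Y * (E n * Q) = P n * (E n * Q) := fun n => by
    rw [hY, mul_assoc, ← mul_assoc Q, ← hEQ, mul_assoc (E n), hQQ, Finset.sum_mul,
      Finset.sum_eq_single n]
    · rw [mul_assoc, hEEQ, if_pos rfl]
    · intro k _ hk
      rw [mul_assoc, hEEQ, if_neg hk, mul_zero]
    · simp
  have hEQs : ∀ n, star (E n * Q) = E n * Q := fun n => by rw [star_mul, hEs, hQs, hEQ]
  have hYsP : ∀ n, star Y * P n = E n * Q * star Y := fun n => by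
    have := congrArg star ((hPY n).trans (hYE n).symm)
    rwa [star_mul, star_mul, hPs, hEQs] at this
  obtain ⟨S, hSu, hSs, hSJ, hSQ, hScomm, hSW⟩ := exists_inv_sqrt hQ hYQ hYn hYJ hYJ'
  have hSE : ∀ n, Commute S (E n * Q) := fun n => by
    refine hScomm _ ?_ ?_
    · change star Y * Y * (E n * Q) = E n * Q * (star Y * Y)
      rw [mul_assoc, hYE, ← hPY, ← mul_assoc, hYsP, mul_assoc]
    · change Q * (E n * Q) = E n * Q * Q
      rw [← mul_assoc, ← hEQ]
  set W := Y * S * Q with hW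
  clear_value W
  have hWE : ∀ n, W * (E n * Q) = P n * W := fun n => by
    calc W * (E n * Q) = Y * S * (Q * (E n * Q)) := by rw [hW, mul_assoc]
      _ = Y * S * (E n * Q) := by rw [← mul_assoc Q, ← hEQ, mul_assoc (E n), hQQ]
      _ = Y * (E n * Q) * S := by rw [mul_assoc, (hSE n).eq]; noncomm_ring
      _ = P n * (Y * Q) * S := by rw [hYE, ← hPY, hYQ]
      _ = P n * W := by rw [hW, mul_assoc Y, hSQ.eq]; noncomm_ring
  have hBY : B * star Y = 0 := by
    have hBQ : B * Q = 0 := by rw [hQdef, mul_sub, hBp.1.eq]; simp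
    rw [hYs, ← mul_assoc, hBQ, zero_mul]
  -- `star Y + B` is within distance less than `1` of `Q + B = 1`.
  have hunit : IsUnit (star Y + B) := by
    have h1 : ‖Q - star Y‖ < 1 := by
      have : Q - star Y = -star (Y - Q) := by rw [star_sub, hQs]; abel
      rw [this, norm_neg, norm_star]
      linarith
    have h2 := (Units.oneSub _ h1).isUnit
    have h3 : 1 - (Q - star Y) = star Y + B := by rw [hQdef]; abel
    rwa [Units.val_oneSub, h3] at h2
  obtain ⟨hKfin, hKrank⟩ := finrank_ker_of_isUnit_add hBY hunit
  have hKP : ∀ n, ∀ x ∈ (star Y).ker, P n x ∈ (star Y).ker := fun n x hx => by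
    have hx' : star Y x = 0 := hx
    change star Y (P n x) = 0
    have := congrArg (fun T : H →L[ℂ] H => T x) (hYsP n)
    simpa [hx'] using this
  obtain ⟨b, hb⟩ := h.exists_orthonormalBasis hKP hKrank
  -- The finitely many vectors `e k` killed by `Q` are matched with an eigenbasis of the kernel of
  -- `star Y`, the orthogonal complement of the range of `W`.
  let f : ℕ → H := fun k => if hk : k ∈ F then (b (F.equivFin ⟨k, hk⟩) : H) else W (e k)
  have hf_mem : ∀ k (hk : k ∈ F), f k = b (F.equivFin ⟨k, hk⟩) := fun k hk => dif_pos hk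
  have hf_not : ∀ k, k ∉ F → f k = W (e k) := fun k hk => dif_neg hk
  have hWin : ∀ x y, inner ℂ (W x) (W y) = inner ℂ x (Q y) := fun x y => by
    rw [← hSW, ContinuousLinearMap.star_eq_adjoint, mul_apply_eq_comp,
      ContinuousLinearMap.adjoint_inner_right]
  have hWK : ∀ x ∈ (star Y).ker, ∀ y, inner ℂ x (W y) = 0 := fun x hx y => by
    have hx' : star Y x = 0 := hx
    rw [hW, mul_assoc, mul_apply_eq_comp, ← ContinuousLinearMap.adjoint_inner_left,
      ← ContinuousLinearMap.star_eq_adjoint, hx', inner_zero_left]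
  have hf : Orthonormal ℂ f := by
    rw [orthonormal_iff_ite]
    intro i j
    by_cases hi : i ∈ F <;> by_cases hj : j ∈ F
    · rw [hf_mem i hi, hf_mem j hj, ← Submodule.coe_inner, orthonormal_iff_ite.mp b.orthonormal]
      simp
    · rw [hf_mem i hi, hf_not j hj, hWK _ (Subtype.property _), if_neg]
      rintro rfl
      exact hj hi
    · rw [hf_not i hi, hf_mem j hj, inner_eq_zero_symm.mp (hWK _ (Subtype.property _) _), if_neg]
      rintro rfl
      exact hi hj
    · rw [hf_not i hi, hf_not j hj, hWin, hQe, if_neg hj, inner_basis]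
  have hf_top : (Submodule.span ℂ (Set.range f))ᗮ = ⊥ := by
    rw [eq_bot_iff]
    intro x hx
    have hx' : ∀ k, inner ℂ (f k) x = 0 := fun k =>
      (Submodule.mem_orthogonal _ _).mp hx _ (Submodule.subset_span ⟨k, rfl⟩)
    have hWx : star W x = 0 := by
      refine ext_inner_basis (e := e) fun k => ?_
      rw [ContinuousLinearMap.star_eq_adjoint, ContinuousLinearMap.adjoint_inner_right,
        inner_zero_right]
      by_cases hk : k ∈ F
      · rw [hW, mul_apply_eq_comp, hQe, if_pos hk, map_zero, inner_zero_left]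
      · rw [← hf_not k hk, hx']
    have hxK : x ∈ (star Y).ker := by
      -- Since `S` is invertible, `star W` and `star Y` have the same kernel; a vector orthogonal to
      -- every `f k` thus lies in that kernel and is orthogonal to its basis `b`.
      have hWs : star W = S * star Y := by
        have hQY : Q * star Y = star Y := by rw [hYs, ← mul_assoc, hQQ]
        rw [hW, star_mul, star_mul, hQs, hSs.star_eq, ← mul_assoc, ← hSQ.eq, mul_assoc, hQY]
      obtain ⟨u, hu⟩ := hSu
      change star Y x = 0
      have : star Y = ↑u⁻¹ * star W := by rw [hWs, ← hu, u.inv_mul_cancel_left]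
      rw [this, mul_apply_eq_comp, hWx, map_zero]
    have hx0 : (⟨x, hxK⟩ : (star Y).ker) = 0 := by
      apply b.repr.injective
      ext i
      rw [b.repr_apply_apply, b.repr_apply_apply, inner_zero_right, Submodule.coe_inner]
      obtain ⟨⟨k, hk⟩, rfl⟩ := F.equivFin.surjective i
      have := hx' k
      rw [hf_mem k hk] at this
      simpa using this
    exact congrArg Subtype.val hx0
  let f' := HilbertBasis.mkOfOrthogonalEqBot hf hf_top
  let V := e.repr.trans f'.repr.symm
  have hVe : ∀ k, (V : H →L[ℂ] H) (e k) = f k := fun k => by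
    change f'.repr.symm (e.repr (e k)) = f k
    rw [e.repr_self, f'.repr_symm_single, HilbertBasis.coe_mkOfOrthogonalEqBot]
  have hVu : (V : H →L[ℂ] H) ∈ unitary (H →L[ℂ] H) :=
    (Unitary.linearIsometryEquiv.symm V).property
  set V' : H →L[ℂ] H := (V : H →L[ℂ] H)
  have hVJ : V' - 1 ∈ J := by
    have hVQ : V' * Q = W := by
      refine clm_ext_basis (e := e) fun k => ?_
      by_cases hk : k ∈ F
      · simp [hW, hQe, hk]
      · rw [mul_apply_eq_comp, hQe, if_neg hk, hVe, hf_not k hk]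
    -- Split along `1 = Q + B` and use `V' * Q = W = Y * S * Q`; the `B` part has finite rank.
    have : V' - 1 = (Y - Q) * S * Q + Q * (S - 1) * Q + (V' - 1) * B := by
      have h1 : (V' - 1) * Q = (Y - Q) * S * Q + Q * (S - 1) * Q := by
        rw [sub_mul, hVQ, one_mul, sub_mul, sub_mul, mul_sub, sub_mul, mul_one, hQQ, hW]
        abel
      rw [← h1, hQdef]
      noncomm_ring
    rw [this]
    exact J.add_mem (J.add_mem (J.mul_mem_right _ _ (J.mul_mem_right _ _ hYJ))
      (J.mul_mem_right _ _ (J.mul_mem_left _ _ hSJ))) (J.mul_mem_left _ _ (basisProj_mem hJ.1 e F))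
  refine ⟨star V', ⟨Unitary.star_mem hVu, sub_one_mem_of_unitary hVu hVJ⟩, ?_⟩
  refine isDiagonal_of_apply_eq_smul fun k => ?_
  obtain ⟨n, hn⟩ : ∃ n, P n (f k) = f k := by
    by_cases hk : k ∈ F
    · rw [hf_mem k hk]
      exact hb _
    · obtain ⟨n, hn, -⟩ := hF₀ k fun hk' => hk (hF hk')
      refine ⟨n, ?_⟩
      rw [hf_not k hk]
      have := congrArg (fun T : H →L[ℂ] H => T (e k)) (hWE n)
      simp only [mul_apply_eq_comp, hQe, if_neg hk, hn] at this
      exact this.symm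
  refine ⟨lam n, ?_⟩
  have hVV : star V' (f k) = e k := by
    have := congrArg (fun T : H →L[ℂ] H => T (e k)) (Unitary.star_mul_self_of_mem hVu)
    simpa [hVe] using this
  rw [star_star, mul_apply_eq_comp, mul_apply_eq_comp, hVe, h.apply_eq_smul hn, map_smul, hVV]

end IsSpectralResolution

end Construction

end RestrictedDiag

theorem theorem3p1 {H : Type*} [NormedAddCommGroup H] [InnerProductSpace ℂ H] [CompleteSpace H]
    (e : HilbertBasis ℕ ℂ H)
    (J : TwoSidedIdeal (H →L[ℂ] H)) (hJ : RestrictedDiag.IsProperIdeal J)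
    (A : H →L[ℂ] H) (hA : IsStarNormal A)
    (N : ℕ) (lam : Fin N → ℂ) (hlam : Function.Injective lam)
    (hspec : Set.range lam = spectrum ℂ A)
    (P : Fin N → (H →L[ℂ] H)) (hP : ∀ n, P n = RestrictedDiag.spectralProjection A (lam n)) :
    List.TFAE [
      RestrictedDiag.IsRestrictedDiagonalizable e J A,
      ∃ E : Fin N → (H →L[ℂ] H), (∀ n, RestrictedDiag.IsDiagonalProjection e (E n)) ∧
        ∀ n, E n - P n ∈ J,
      ∃ E : Fin N → (H →L[ℂ] H), (∀ n, RestrictedDiag.IsDiagonalProjection e (E n)) ∧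
        ∑ n, (1 - E n) * P n ∈ J ∧ ∑ n, E n * (1 - P n) ∈ J] := by
  have h : RestrictedDiag.IsSpectralResolution A lam P := by
    rw [funext hP]
    exact RestrictedDiag.isSpectralResolution_spectralProjection hA hlam hspec
  tfae_have 1 → 2 := h.exists_diagonalProjection hlam
  tfae_have 2 → 3 := fun ⟨E, hE, hEP⟩ => ⟨E, hE,
    RestrictedDiag.sum_mem_of_forall_sub_mem (fun n => (hE n).1.1)
      (fun n => (h.isStarProjection n).1) hEP⟩
  tfae_have 3 → 1 := fun ⟨E, hE, h1, h2⟩ => by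
    obtain ⟨hEP, F₀, hF₀⟩ := h.exists_partition hJ hE h1 h2
    exact h.isRestrictedDiagonalizable hJ hE hEP hF₀
  tfae_finish
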